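/- Let $p$ be a prime, let $G$ be a finite group, and let $P$ be a Sylow $p$-subgroup of $G$. Write $P'$ for the commutator subgroup of $P$, $\Phi(P)$ for its Frattini subgroup, and $N_G(P)$ for the normalizer of $P$ in $G$. A finite group is called $p$-solvable if each of its chief factors has order a power of $p$ or order not divisible by $p$, and $p$-supersolvable if each of its chief factors has order exactly $p$ or order not divisible by $p$. A subgroup $H$ of $G$ is called $s$-semipermutable in $G$ if $HQ = QH$ for every prime $q$ not dividing $|H|$ and every Sylow $q$-subgroup $Q$ of $G$. Theorem. Suppose that $G$ is $p$-solvable, that there is a subgroup $H$ of $P$ with $P' \le H \le \Phi(P)$ which is $s$-semipermutable in $G$, and that $N_G(P)$ is $p$-supersolvable. Then $G$ is $p$-supersolvable. -/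

import Mathlib

open scoped Pointwise

/-- `L / K` is a chief factor of `G`: `K < L` are normal subgroups of `G`, and no normal subgroup
of `G` lies strictly between them. The order of the factor is the index `K.relIndex L = |L : K|`. -/
structure IsChiefFactor {G : Type*} [Group G] (K L : Subgroup G) : Prop where
  normal_bot : K.Normal
  normal_top : L.Normal
  lt : K < L
  eq_or_eq : ∀ N : Subgroup G, N.Normal → K ≤ N → N ≤ L → N = K ∨ N = L

/-- A finite group is `p`-solvable if each of its chief factors is a `p`-group or a `p'`-group
(its order is a power of `p`, or is not divisible by `p`). -/
def IsPSolvable (p : ℕ) (G : Type*) [Group G] : Prop :=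
  ∀ K L : Subgroup G, IsChiefFactor K L →
    (∃ n : ℕ, K.relIndex L = p ^ n) ∨ ¬ p ∣ K.relIndex L

/-- A finite group is `p`-supersolvable if each of its chief factors has order `p` or has order
not divisible by `p`. -/
def IsPSupersolvable (p : ℕ) (G : Type*) [Group G] : Prop :=
  ∀ K L : Subgroup G, IsChiefFactor K L →
    K.relIndex L = p ∨ ¬ p ∣ K.relIndex L

/-- `H` is `s`-semipermutable in the finite group `G`: `HQ = QH` for every Sylow `q`-subgroup `Q`
of `G`, for every prime `q` not dividing `|H|`. -/
def IsSSemipermutable {G : Type*} [Group G] (H : Subgroup G) : Prop :=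
  ∀ q : ℕ, q.Prime → ¬ q ∣ Nat.card H → ∀ Q : Sylow q G,
    (H : Set G) * (Q : Set G) = (Q : Set G) * (H : Set G)

/-!
Everything reduces to showing that `G` has `p`-length one, in the form: some normal subgroup `K` of
order prime to `p` makes `PK` normal (`IsNongeneratingPermutable.exists_normal_sup_normal`). The
Frattini argument then gives `G = K N_G(P)`, so `G ⧸ K` is a quotient of `N_G(P)` and is therefore
`p`-supersolvable, and a normal subgroup of order prime to `p` does not affect
`p`-supersolvability (`IsPSupersolvable.of_normalizer`).

The `p`-length claim uses only `P' ≤ H ≤ Φ(P)`, the permutability of `H` and the `p`-solvability of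
`G`, and it goes by induction on `|G|`. If `G` has a nontrivial normal `p'`-subgroup, pass to the
quotient. Otherwise let `V = O_p(G)`, the normal core of `P`, and `D = H ∩ V`. For a Sylow
`q`-subgroup `Q` with `q ≠ p`, the product `HQ` is a subgroup with `HQ ∩ V = D`, so `Q` normalizes
`D`; since `P` does too, `D` is normal in `G`
(`IsNongeneratingPermutable.normal_inf_normalCore`).

* If `D = 1`, then `[P, V] ≤ P' ∩ V ≤ D = 1`, so `P ≤ C_G(V) ≤ V` by the Hall–Higman lemma
  (`IsPSolvable.centralizer_normalCore_le`), and `P` is normal.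
* If `D ≠ 1`, then its centre `A` is a nontrivial abelian normal subgroup of `G` inside `Φ(P)`. By
  induction `G ⧸ A` has a normal `p'`-subgroup `K ⧸ A` with `PK` normal. If `R` is a complement of
  `A` in `K`, all complements of `A` in `K` are conjugate under `A`, so `G = A N_G(R)`
  (`Subgroup.exists_complement_forall_exists_mul_mem_normalizer`); as `A` consists of nongenerators
  of `P`, this forces `P ≤ N_G(R)`. Thus `R` is normal in `G`, and `PR = PK`.
-/

/-! ### Chief factors and quotients -/

theorem IsChiefFactor.comap {G G' : Type*} [Group G] [Group G'] {f : G →* G'}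
    (hf : Function.Surjective f) {K L : Subgroup G'} (h : IsChiefFactor K L) :
    IsChiefFactor (K.comap f) (L.comap f) where
  normal_bot := h.normal_bot.comap f
  normal_top := h.normal_top.comap f
  lt := (Subgroup.comap_lt_comap_of_surjective hf).2 h.lt
  eq_or_eq N hN hKN hNL := by
    have hker : f.ker ≤ N := le_trans (fun x hx => by
      rw [Subgroup.mem_comap, MonoidHom.mem_ker.1 hx]; exact one_mem K) hKN
    have hN' : (N.map f).comap f = N := Subgroup.comap_map_eq_self hker
    have h₁ : K ≤ N.map f := by
      rw [← Subgroup.comap_le_comap_of_surjective hf, hN']; exact hKN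
    have h₂ : N.map f ≤ L := Subgroup.map_le_iff_le_comap.2 hNL
    rw [← hN']
    exact (h.eq_or_eq _ (hN.map f hf) h₁ h₂).imp (congrArg _) (congrArg _)

theorem relIndex_comap_comap_of_surjective {G G' : Type*} [Group G] [Group G'] {f : G →* G'}
    (hf : Function.Surjective f) (K L : Subgroup G') :
    (K.comap f).relIndex (L.comap f) = K.relIndex L := by
  rw [Subgroup.relIndex_comap, Subgroup.map_comap_eq_self_of_surjective hf]

theorem IsPSolvable.of_surjective {p : ℕ} {G G' : Type*} [Group G] [Group G'] {f : G →* G'}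
    (hf : Function.Surjective f) (h : IsPSolvable p G) : IsPSolvable p G' := fun K L hKL => by
  rw [← relIndex_comap_comap_of_surjective hf]
  exact h _ _ (hKL.comap hf)

theorem IsPSupersolvable.of_surjective {p : ℕ} {G G' : Type*} [Group G] [Group G'] {f : G →* G'}
    (hf : Function.Surjective f) (h : IsPSupersolvable p G) : IsPSupersolvable p G' :=
  fun K L hKL => by
  rw [← relIndex_comap_comap_of_surjective hf]
  exact h _ _ (hKL.comap hf)

/-- A chief factor `M / L` with `K ∩ M ≤ L` maps to a chief factor of `G ⧸ K` of the same order.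
Otherwise `M = L (K ∩ M)`, so that the order of `M / L` divides that of `K`. -/
theorem IsPSupersolvable.of_quotient {p : ℕ} {G : Type*} [Group G] (K : Subgroup G) [K.Normal]
    (hK : ¬ p ∣ Nat.card K) (h : IsPSupersolvable p (G ⧸ K)) : IsPSupersolvable p G := by
  intro L M hLM
  by_contra! hcon
  obtain ⟨hne, hdvd⟩ := hcon
  have := hLM.normal_bot
  have := hLM.normal_top
  have hKM : K ⊓ M ≤ L := by
    rcases hLM.eq_or_eq (L ⊔ (K ⊓ M)) inferInstance le_sup_left
      (sup_le hLM.lt.le inf_le_right) with h₁ | h₁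
    · exact sup_eq_left.1 h₁
    · refine absurd ?_ hK
      rw [← h₁, Subgroup.relIndex_sup_left] at hdvd
      exact hdvd.trans ((Subgroup.relIndex_dvd_card _ _).trans
        (Subgroup.card_dvd_of_le inf_le_left))
  set f := QuotientGroup.mk' K
  have hf : Function.Surjective f := QuotientGroup.mk'_surjective K
  have hmem : ∀ l ∈ L, ∀ m ∈ M, f l = f m → m ∈ L := fun l hl m hm hlm => by
    have h₁ : l⁻¹ * m ∈ K := QuotientGroup.eq.1 hlm
    have h₂ : l⁻¹ * m ∈ L := hKM ⟨h₁, M.mul_mem (M.inv_mem (hLM.lt.le hl)) hm⟩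
    simpa using mul_mem hl h₂
  have hinf : (L.map f).comap f ⊓ M = L := by
    refine le_antisymm ?_ (le_inf (Subgroup.le_comap_map f L) hLM.lt.le)
    rintro m ⟨⟨l, hl, hlm⟩, hm⟩
    exact hmem l hl m hm hlm
  have hchief : IsChiefFactor (L.map f) (M.map f) := by
    refine ⟨hLM.normal_bot.map f hf, hLM.normal_top.map f hf,
      lt_of_le_not_ge (Subgroup.map_mono hLM.lt.le) fun hle => hLM.lt.not_ge fun m hm => ?_, ?_⟩
    · obtain ⟨l, hl, hlm⟩ := hle ⟨m, hm, rfl⟩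
      exact hmem l hl m hm hlm
    · intro X hX hLX hXM
      have := hX
      rcases hLM.eq_or_eq (X.comap f ⊓ M) inferInstance
        (le_inf (Subgroup.map_le_iff_le_comap.1 hLX) hLM.lt.le) inf_le_right with h₁ | h₁
      · refine Or.inl (le_antisymm (fun x hx => ?_) hLX)
        obtain ⟨m, hm, rfl⟩ := hXM hx
        exact ⟨m, h₁ ▸ ⟨hx, hm⟩, rfl⟩
      · exact Or.inr (le_antisymm hXM (Subgroup.map_le_iff_le_comap.2 (inf_eq_right.1 h₁)))
  have hidx : (L.map f).relIndex (M.map f) = L.relIndex M := by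
    rw [← Subgroup.relIndex_comap, ← Subgroup.inf_relIndex_right, hinf]
  rcases h _ _ hchief with h₁ | h₁ <;> rw [hidx] at h₁
  exacts [hne h₁, h₁ hdvd]

/-! ### Complements of an abelian normal subgroup -/

section Complements
open Subgroup MulAction

/-- The class in `A.QuotientDiff` of a complement `R` of `A`, regarded as a transversal of `A`. -/
def Subgroup.IsComplement'.quotientDiff {G : Type*} [Group G] {A R : Subgroup G}
    [IsMulCommutative A] [A.FiniteIndex] (hR : IsComplement' A R) : A.QuotientDiff :=
  Quotient.mk'' ⟨R, hR.symm⟩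

/-- A complement fixes its own class, because `R` acts on transversals by right multiplication and
`R * r⁻¹ = R` for `r ∈ R`. Comparing orders, it is the whole stabilizer. -/
theorem Subgroup.IsComplement'.stabilizer_quotientDiff {G : Type*} [Group G] [Finite G]
    {A R : Subgroup G} [A.Normal] [IsMulCommutative A] (hA : (Nat.card A).Coprime A.index)
    (hR : IsComplement' A R) : stabilizer G hR.quotientDiff = R := by
  refine (eq_of_le_of_card_ge (fun r hr => ?_) ?_).symm
  · rw [mem_stabilizer_iff]
    change Quotient.mk'' (MulOpposite.op r⁻¹ • (⟨R, hR.symm⟩ : A.LeftTransversal)) = _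
    refine congrArg Quotient.mk'' (Subtype.ext ?_)
    change MulOpposite.op r⁻¹ • (R : Set G) = R
    exact op_smul_coe_set (inv_mem hr)
  · rw [← hR.symm.index_eq_card, ← (isComplement'_stabilizer_of_coprime hA).symm.index_eq_card]

/-- The conjugacy part of the Schur–Zassenhaus theorem for an abelian normal subgroup `A`. -/
theorem Subgroup.IsComplement'.exists_map_conj_eq {G : Type*} [Group G] [Finite G]
    {A R S : Subgroup G} [A.Normal] [IsMulCommutative A] (hA : (Nat.card A).Coprime A.index)
    (hR : IsComplement' A R) (hS : IsComplement' A S) :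
    ∃ a ∈ A, R.map (MulAut.conj a).toMonoidHom = S := by
  obtain ⟨a, ha⟩ := exists_smul_eq hA hR.quotientDiff hS.quotientDiff
  refine ⟨a, a.2, ?_⟩
  have h := stabilizer_smul_eq_stabilizer_map_conj (a : G) hR.quotientDiff
  rw [hR.stabilizer_quotientDiff hA] at h
  rw [← hS.stabilizer_quotientDiff hA, ← ha]
  exact h.symm

/-- A Frattini argument for complements: if `A ≤ K` are normal in `G`, with `A` abelian of order
prime to `|K : A|`, then `A` has a complement `R` in `K` with `G = A N_G(R)`. -/
theorem Subgroup.exists_complement_forall_exists_mul_mem_normalizer {G : Type*} [Group G]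
    [Finite G] {A K : Subgroup G} [A.Normal] [K.Normal] [IsMulCommutative A] (hAK : A ≤ K)
    (hA : (Nat.card A).Coprime (A.relIndex K)) :
    ∃ R : Subgroup G, Nat.card R = A.relIndex K ∧ A ⊔ R = K ∧
      ∀ g : G, ∃ a ∈ A, a⁻¹ * g ∈ normalizer (R : Set G) := by
  have hcard : Nat.card (A.subgroupOf K) = Nat.card A :=
    Nat.card_congr (subgroupOfEquivOfLe hAK).toEquiv
  have hA' : (Nat.card (A.subgroupOf K)).Coprime (A.subgroupOf K).index := by rwa [hcard]
  obtain ⟨R, hR⟩ := exists_right_complement'_of_coprime hA'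
  have hRc : Nat.card (R.map K.subtype) = A.relIndex K :=
    (card_map_of_injective K.subtype_injective).trans hR.symm.index_eq_card.symm
  refine ⟨R.map K.subtype, hRc, ?_, fun g => ?_⟩
  · have h := congrArg (Subgroup.map K.subtype) hR.sup_eq_top
    rwa [map_sup, subgroupOf_map_subtype, inf_eq_left.2 hAK, ← MonoidHom.range_eq_map,
      range_subtype] at h
  · have hcardR : Nat.card (R.map (MulAut.conjNormal g : MulAut K).toMonoidHom) = Nat.card R :=
      card_map_of_injective (MulAut.conjNormal g : MulAut K).injective
    have hS : IsComplement' (A.subgroupOf K)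
        (R.map (MulAut.conjNormal g : MulAut K).toMonoidHom) := by
      refine isComplement'_of_coprime ?_ ?_
      · rw [hcardR, hR.card_mul_card]
      · rwa [hcardR, ← hR.symm.index_eq_card]
    obtain ⟨a, ha, haR⟩ := hR.exists_map_conj_eq hA' hS
    refine ⟨a, ha, ?_⟩
    have key : (R.map K.subtype).map (MulAut.conj g).toMonoidHom =
        (R.map K.subtype).map (MulAut.conj (a : G)).toMonoidHom := by
      have h := congrArg (Subgroup.map K.subtype) haR
      rw [map_map, map_map] at h
      rw [map_map, map_map]
      exact h.symm
    rw [mem_normalizer_iff]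
    intro x
    have h₁ : x ∈ R.map K.subtype ↔
        g * x * g⁻¹ ∈ (R.map K.subtype).map (MulAut.conj g).toMonoidHom :=
      (mem_map_iff_mem (MulAut.conj g).injective).symm
    have h₂ : (a : G)⁻¹ * g * x * ((a : G)⁻¹ * g)⁻¹ ∈ R.map K.subtype ↔
        a * ((a : G)⁻¹ * g * x * ((a : G)⁻¹ * g)⁻¹) * (a : G)⁻¹ ∈
          (R.map K.subtype).map (MulAut.conj (a : G)).toMonoidHom :=
      (mem_map_iff_mem (MulAut.conj (a : G)).injective).symm
    have h₃ : a * ((a : G)⁻¹ * g * x * ((a : G)⁻¹ * g)⁻¹) * (a : G)⁻¹ = g * x * g⁻¹ := by group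
    exact h₁.trans (by rw [h₂, h₃, key])

end Complements

/-! ### Permutable subgroups of a Sylow subgroup -/

section PLength
open Subgroup
open scoped commutatorElement

/-- The condition on `H` relative to a Sylow subgroup `P`. Both `H ≤ Φ(P)` and
`s`-semipermutability are put in a form that passes to quotients: the first says that no proper
subgroup of `P` together with `H` generates `P`, the second is required for all primes `q ≠ p`,
whether or not `H` is trivial. -/
structure IsNongeneratingPermutable {p : ℕ} {G : Type*} [Group G] (P : Sylow p G)
    (H : Subgroup G) : Prop where
  commutator_le : ⁅(P : Subgroup G), (P : Subgroup G)⁆ ≤ H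
  le : H ≤ P
  eq_of_sup_eq : ∀ S : Subgroup G, S ≤ P → S ⊔ H = P → S = P
  mul_comm : ∀ q : ℕ, q.Prime → q ≠ p → ∀ Q : Sylow q G,
    (H : Set G) * (Q : Set G) = (Q : Set G) * (H : Set G)

theorem IsNongeneratingPermutable.map {p : ℕ} [Fact p.Prime] {G G' : Type*} [Group G] [Finite G]
    [Group G'] {P : Sylow p G} {H : Subgroup G} (h : IsNongeneratingPermutable P H) {f : G →* G'}
    (hf : Function.Surjective f) : IsNongeneratingPermutable (P.mapSurjective hf) (H.map f) where
  commutator_le := by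
    rw [Sylow.coe_mapSurjective, ← map_commutator]
    exact map_mono h.commutator_le
  le := map_mono h.le
  eq_of_sup_eq S hS hSH := by
    rw [Sylow.coe_mapSurjective] at *
    have hmap : ((P : Subgroup G) ⊓ S.comap f).map f = S := by
      refine le_antisymm (map_le_iff_le_comap.2 inf_le_right) fun y hy => ?_
      obtain ⟨x, hx, rfl⟩ := hS hy
      exact ⟨x, ⟨hx, hy⟩, rfl⟩
    rw [← hmap]
    refine congrArg (Subgroup.map f) (h.eq_of_sup_eq _ inf_le_left
      (le_antisymm (sup_le inf_le_left h.le) fun x hx => ?_))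
    -- An element of `P` agrees modulo `P ⊓ ker f` with an element of `(P ⊓ f⁻¹(S)) ⊔ H`.
    have hfx : f x ∈ ((P : Subgroup G) ⊓ S.comap f ⊔ H).map f := by
      rw [Subgroup.map_sup, hmap, hSH]
      exact mem_map_of_mem f hx
    obtain ⟨y, hy, hyx⟩ := hfx
    have hyP : y ∈ (P : Subgroup G) := sup_le inf_le_left h.le hy
    have hker : y⁻¹ * x ∈ (P : Subgroup G) ⊓ S.comap f := by
      refine ⟨Subgroup.mul_mem _ (Subgroup.inv_mem _ hyP) hx, ?_⟩
      change f (y⁻¹ * x) ∈ S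
      rw [map_mul, map_inv, hyx, inv_mul_cancel]
      exact one_mem S
    simpa using mul_mem hy (mem_sup_left hker : _ ∈ (P : Subgroup G) ⊓ S.comap f ⊔ H)
  mul_comm q hq hqp Q := by
    have : Fact q.Prime := ⟨hq⟩
    obtain ⟨Q, rfl⟩ := Sylow.mapSurjective_surjective hf q Q
    have := congrArg (f '' ·) (h.mul_comm q hq hqp Q)
    simpa only [Set.image_mul, Subgroup.coe_map, ← Sylow.coe_coe,
      Sylow.coe_mapSurjective] using this

theorem Subgroup.eq_top_of_forall_exists_sylow_le {G : Type*} [Group G] [Finite G]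
    {T : Subgroup G} (h : ∀ q : ℕ, q.Prime → ∃ Q : Sylow q G, (Q : Subgroup G) ≤ T) : T = ⊤ := by
  rw [← index_eq_one]
  by_contra hne
  obtain ⟨q, hq, hdvd⟩ := Nat.exists_prime_and_dvd hne
  have : Fact q.Prime := ⟨hq⟩
  obtain ⟨Q, hQ⟩ := h q hq
  exact Q.not_dvd_index (hdvd.trans (index_dvd_of_le hQ))

theorem Subgroup.le_normalizer_of_conj_mem {G : Type*} [Group G] {T D : Subgroup G}
    (h : ∀ x ∈ T, ∀ d ∈ D, x * d * x⁻¹ ∈ D) : T ≤ normalizer (D : Set G) := by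
  intro x hx
  rw [mem_normalizer_iff]
  refine fun d => ⟨h x hx d, fun hd => ?_⟩
  have := h x⁻¹ (inv_mem hx) _ hd
  rwa [show x⁻¹ * (x * d * x⁻¹) * x⁻¹⁻¹ = d by group] at this

/-- The normal core of `P` is `O_p(G)`. If `Q` is a Sylow `q`-subgroup with `q ≠ p`, then
`HQ ∩ O_p(G) = H ∩ O_p(G)` because `P ∩ Q = 1`, so `Q` normalizes `H ∩ O_p(G)`. So does `P`, which
normalizes `H`. -/
theorem IsNongeneratingPermutable.normal_inf_normalCore {p : ℕ} [hp : Fact p.Prime] {G : Type*}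
    [Group G] [Finite G] {P : Sylow p G} {H : Subgroup G} (h : IsNongeneratingPermutable P H) :
    (H ⊓ (P : Subgroup G).normalCore).Normal := by
  rw [← normalizer_eq_top_iff]
  refine eq_top_of_forall_exists_sylow_le fun q hq => ?_
  obtain rfl | hqp := eq_or_ne q p
  · refine ⟨P, le_normalizer_of_conj_mem fun x hx d hd =>
      ⟨?_, (normalCore_normal _).conj_mem d hd.2 x⟩⟩
    have hc : ⁅x, d⁆ ∈ H := h.commutator_le (commutator_mem_commutator hx (h.le hd.1))
    simpa [commutatorElement_def] using mul_mem hc hd.1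
  · have : Fact q.Prime := ⟨hq⟩
    have Q : Sylow q G := default
    refine ⟨Q, le_normalizer_of_conj_mem fun x hx d hd => ?_⟩
    have hV := (normalCore_normal (P : Subgroup G)).conj_mem d hd.2 x
    refine ⟨?_, hV⟩
    have hxd : x * d ∈ (H : Set G) * (Q : Set G) := by
      rw [h.mul_comm q hq hqp Q]
      exact Set.mul_mem_mul hx hd.1
    obtain ⟨a, ha, y, hy, hay⟩ := hxd
    change a * y = x * d at hay
    rw [← hay] at hV ⊢
    have hyP : y * x⁻¹ ∈ (P : Subgroup G) := by
      have := mul_mem (inv_mem (h.le ha)) (normalCore_le _ hV)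
      rwa [mul_assoc, inv_mul_cancel_left] at this
    have h1 : y * x⁻¹ = 1 := disjoint_def.1
      (IsPGroup.disjoint_of_ne p q hqp.symm P Q P.isPGroup' Q.isPGroup') hyP
      (mul_mem hy (inv_mem hx))
    rwa [mul_assoc, h1, mul_one]

/-! ### The Hall–Higman lemma and `p`-length one -/

/-- The Hall–Higman lemma `C_G(O_p(G)) ≤ O_p(G)` for a `p`-solvable group with `O_{p'}(G) = 1`. -/
theorem IsPSolvable.centralizer_normalCore_le {p : ℕ} [hp : Fact p.Prime] {G : Type*} [Group G]
    [Finite G] (hG : IsPSolvable p G) (P : Sylow p G)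
    (hO : ∀ K : Subgroup G, K.Normal → ¬ p ∣ Nat.card K → K = ⊥) :
    centralizer ((P : Subgroup G).normalCore : Set G) ≤ (P : Subgroup G).normalCore := by
  set V := (P : Subgroup G).normalCore
  set C := centralizer (V : Set G)
  by_contra hCV
  have hZC : C ⊓ V < C := inf_lt_left.2 hCV
  obtain ⟨L, hL⟩ := exists_minimal_of_wellFoundedLT
    (fun L : Subgroup G => L.Normal ∧ C ⊓ V < L ∧ L ≤ C) ⟨C, inferInstance, hZC, le_rfl⟩
  obtain ⟨hLn, hZL, hLC⟩ := hL.prop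
  have hchief : IsChiefFactor (C ⊓ V) L := by
    refine ⟨inferInstance, hLn, hZL, fun N hN hZN hNL => ?_⟩
    refine hZN.eq_or_lt.imp Eq.symm fun hlt => ?_
    exact le_antisymm hNL (hL.le_of_le ⟨hN, hlt, hNL.trans hLC⟩ hNL)
  have hZp : IsPGroup p (C ⊓ V : Subgroup G) :=
    P.isPGroup'.to_le (inf_le_right.trans (normalCore_le _))
  obtain ⟨m, hm⟩ := IsPGroup.iff_card.1 hZp
  rcases hG _ _ hchief with ⟨n, hn⟩ | hnd
  · -- The factor is a `p`-group, so `L` is a normal `p`-subgroup and lies in `O_p(G)`.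
    have hcard : Nat.card L = p ^ (m + n) := by
      have := relIndex_mul_relIndex ⊥ (C ⊓ V) L bot_le hZL.le
      rw [relIndex_bot_left, relIndex_bot_left, hm, hn] at this
      rw [← this, pow_add]
    have hLV : L ≤ V := normal_le_normalCore.2
      (IsPGroup.le_sylow_of_normal (IsPGroup.of_card hcard) P)
    exact hZL.not_ge (le_inf hLC hLV)
  · -- The factor is a `p'`-group, so `L` has a complement of `C ⊓ V`, and this is normal in `G`.
    have hcent : ∀ z ∈ C ⊓ V, ∀ x ∈ C, z * x = x * z :=
      fun z hz x hx => mem_centralizer_iff.1 hx z hz.2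
    have : IsMulCommutative (C ⊓ V : Subgroup G) :=
      IsMulCommutative.of_setLike_mul_comm fun a ha b hb => hcent a ha b hb.1
    obtain ⟨R, hRc, hRL, hR⟩ := exists_complement_forall_exists_mul_mem_normalizer hZL.le
      (by rw [hm]; exact Nat.Coprime.pow_left m ((Nat.Prime.coprime_iff_not_dvd hp.out).2 hnd))
    have hRC : R ≤ C := (le_sup_right.trans hRL.le).trans hLC
    have hZN : C ⊓ V ≤ normalizer (R : Set G) := le_normalizer_of_conj_mem fun z hz r hr => by
      rwa [hcent z hz r (hRC hr), mul_inv_cancel_right]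
    have hRn : R.Normal := normalizer_eq_top_iff.1 <| eq_top_iff.2 fun g _ => by
      obtain ⟨a, ha, hag⟩ := hR g
      simpa using mul_mem (hZN ha) hag
    have hR1 : R = ⊥ := hO R hRn (hRc ▸ hnd)
    rw [hR1, sup_bot_eq] at hRL
    exact hZL.ne hRL

/-- A normal `p'`-subgroup of `G ⧸ N` whose product with the image of `P` is normal, pulled back
to `G`. -/
theorem exists_normal_sup_normal_of_quotient {p : ℕ} [Fact p.Prime] {G : Type*} [Group G]
    [Finite G] (P : Sylow p G) (N : Subgroup G) [N.Normal]
    (h : ∃ K : Subgroup (G ⧸ N), K.Normal ∧ ¬ p ∣ Nat.card K ∧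
      (((P.mapSurjective (QuotientGroup.mk'_surjective N) : Sylow p (G ⧸ N)) :
        Subgroup (G ⧸ N)) ⊔ K).Normal) :
    ∃ K : Subgroup G, K.Normal ∧ N ≤ K ∧ ¬ p ∣ N.relIndex K ∧ ((P : Subgroup G) ⊔ K).Normal := by
  obtain ⟨K, hK, hKp, hPK⟩ := h
  have hf := QuotientGroup.mk'_surjective N
  have hNK : N ≤ K.comap (QuotientGroup.mk' N) := by
    conv_lhs => rw [← QuotientGroup.ker_mk' N]
    exact comap_mono bot_le
  refine ⟨K.comap (QuotientGroup.mk' N), hK.comap _, hNK, ?_, ?_⟩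
  · have h₁ := relIndex_ker (K := K.comap (QuotientGroup.mk' N)) (QuotientGroup.mk' N)
    rw [QuotientGroup.ker_mk', map_comap_eq_self_of_surjective hf] at h₁
    rwa [h₁]
  · have h₁ : (QuotientGroup.mk' N).ker ≤ (P : Subgroup G) ⊔ K.comap (QuotientGroup.mk' N) := by
      rw [QuotientGroup.ker_mk']
      exact hNK.trans le_sup_right
    rw [← comap_map_eq_self h₁, Subgroup.map_sup, map_comap_eq_self_of_surjective hf]
    exact hPK.comap _

/-- A `p`-solvable group with such a subgroup `H` has `p`-length at most one: `PK` is normal for some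
normal `p'`-subgroup `K`. -/
theorem IsNongeneratingPermutable.exists_normal_sup_normal {p : ℕ} [hp : Fact p.Prime] {G : Type*}
    [Group G] [Finite G] (hG : IsPSolvable p G) {P : Sylow p G} {H : Subgroup G}
    (h : IsNongeneratingPermutable P H) :
    ∃ K : Subgroup G, K.Normal ∧ ¬ p ∣ Nat.card K ∧ ((P : Subgroup G) ⊔ K).Normal := by
  induction hn : Nat.card G using Nat.strong_induction_on generalizing G with
  | _ n ih =>
  have hquot : ∀ N : Subgroup G, N.Normal → N ≠ ⊥ → ∃ K : Subgroup G,
      K.Normal ∧ N ≤ K ∧ ¬ p ∣ N.relIndex K ∧ ((P : Subgroup G) ⊔ K).Normal := by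
    intro N hN hN1
    have hf := QuotientGroup.mk'_surjective N
    refine exists_normal_sup_normal_of_quotient P N
      (ih (Nat.card (G ⧸ N)) ?_ (hG.of_surjective hf) (h.map hf) rfl)
    rw [← hn, card_eq_card_quotient_mul_card_subgroup N]
    exact lt_mul_of_one_lt_right Nat.card_pos ((one_lt_card_iff_ne_bot N).2 hN1)
  by_cases hO : ∀ K : Subgroup G, K.Normal → ¬ p ∣ Nat.card K → K = ⊥
  swap
  · push Not at hO
    obtain ⟨N, hN, hNp, hN1⟩ := hO
    obtain ⟨K, hK, hNK, hKp, hPK⟩ := hquot N hN hN1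
    refine ⟨K, hK, ?_, hPK⟩
    have := relIndex_mul_relIndex ⊥ N K bot_le hNK
    rw [relIndex_bot_left, relIndex_bot_left] at this
    rw [← this]
    exact hp.out.not_dvd_mul hNp hKp
  set V := (P : Subgroup G).normalCore
  have hDn : (H ⊓ V).Normal := h.normal_inf_normalCore
  by_cases hD : H ⊓ V = ⊥
  · -- Here `⁅P, O_p(G)⁆ ≤ H ⊓ O_p(G) = 1`, so `P = O_p(G)` by the Hall–Higman lemma.
    have hPC : (P : Subgroup G) ≤ centralizer (V : Set G) := fun x hx => by
      rw [mem_centralizer_iff_commutator_eq_one]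
      intro v hv
      have hmem : ⁅v, x⁆ ∈ H ⊓ V :=
        ⟨h.commutator_le (commutator_mem_commutator (normalCore_le _ hv) hx), by
          have := mul_mem hv ((normalCore_normal (P : Subgroup G)).conj_mem _ (inv_mem hv) x)
          simpa [commutatorElement_def, mul_assoc] using this⟩
      rwa [hD, mem_bot] at hmem
    have hPV : (P : Subgroup G) = V :=
      le_antisymm (hPC.trans (hG.centralizer_normalCore_le P hO)) (normalCore_le _)
    refine ⟨⊥, inferInstance, by simpa using hp.out.one_lt.ne', ?_⟩
    rw [sup_bot_eq, hPV]
    exact normalCore_normal _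
  · -- Divide by the centre `A` of `H ⊓ O_p(G)`. A complement `R` of `A` in the preimage `K` of the
    -- normal `p'`-subgroup of `G ⧸ A` is normal: `G = A N_G(R)` gives `P = A (P ⊓ N_G(R))`, so
    -- `P ≤ N_G(R)`, and hence `A ≤ N_G(R)`.
    have hDp : IsPGroup p (H ⊓ V : Subgroup G) := P.isPGroup'.to_le (inf_le_left.trans h.le)
    have : Nontrivial (H ⊓ V : Subgroup G) := (nontrivial_iff_ne_bot _).2 hD
    set A : Subgroup G := (center (H ⊓ V : Subgroup G)).map (H ⊓ V).subtype
    have hA1 : A ≠ ⊥ := fun hA =>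
      hDp.bot_lt_center.ne' ((map_eq_bot_iff_of_injective _ (subtype_injective _)).1 hA)
    have hAn : A.Normal := inferInstance
    have hAH : A ≤ H := (map_subtype_le _).trans inf_le_left
    obtain ⟨m, hm⟩ := IsPGroup.iff_card.1 (P.isPGroup'.to_le (hAH.trans h.le))
    obtain ⟨K, hK, hAK, hKp, hPK⟩ := hquot A hAn hA1
    obtain ⟨R, hRc, hAR, hR⟩ := exists_complement_forall_exists_mul_mem_normalizer hAK
      (by rw [hm]; exact Nat.Coprime.pow_left m ((Nat.Prime.coprime_iff_not_dvd hp.out).2 hKp))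
    have hPR : (P : Subgroup G) ⊓ normalizer (R : Set G) = P := by
      refine h.eq_of_sup_eq _ inf_le_left (le_antisymm (sup_le inf_le_left h.le) fun x hx => ?_)
      obtain ⟨a, ha, hax⟩ := hR x
      have h₁ : a⁻¹ * x ∈ (P : Subgroup G) ⊓ normalizer (R : Set G) :=
        ⟨Subgroup.mul_mem _ (Subgroup.inv_mem _ (h.le (hAH ha))) hx, hax⟩
      simpa using mul_mem (mem_sup_right (hAH ha)) (mem_sup_left h₁ : _ ∈ _ ⊔ H)
    have hAN : A ≤ normalizer (R : Set G) := (hAH.trans h.le).trans (inf_eq_left.1 hPR)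
    have hRn : R.Normal := normalizer_eq_top_iff.1 <| eq_top_iff.2 fun g _ => by
      obtain ⟨a, ha, hag⟩ := hR g
      simpa using mul_mem (hAN ha) hag
    refine ⟨R, hRn, hRc ▸ hKp, ?_⟩
    rwa [← sup_eq_left.2 (hAH.trans h.le), sup_assoc, hAR]

/-- By the Frattini argument `G = K N_G(P)`, so `N_G(P)` maps onto `G ⧸ K`. -/
theorem IsPSupersolvable.of_normalizer {p : ℕ} [Fact p.Prime] {G : Type*} [Group G] [Finite G]
    (P : Sylow p G) (hN : IsPSupersolvable p (normalizer (P : Set G))) {K : Subgroup G}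
    [K.Normal] (hK : ¬ p ∣ Nat.card K) (hPK : ((P : Subgroup G) ⊔ K).Normal) :
    IsPSupersolvable p G := by
  refine IsPSupersolvable.of_quotient K hK
    (hN.of_surjective (f := (QuotientGroup.mk' K).comp (normalizer (P : Set G)).subtype) ?_)
  have htop : normalizer (P : Set G) ⊔ K = ⊤ := by
    have h := P.normalizer_sup_eq_top' (N := (P : Subgroup G) ⊔ K) le_sup_left
    have hle : (P : Subgroup G) ≤ normalizer (P : Set G) := le_normalizer
    rwa [← sup_assoc, sup_eq_left.2 hle] at h
  rw [← MonoidHom.range_eq_top, MonoidHom.range_comp, range_subtype]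
  have h := congrArg (Subgroup.map (QuotientGroup.mk' K)) htop
  rwa [Subgroup.map_sup, map_top_of_surjective _ (QuotientGroup.mk'_surjective K),
    QuotientGroup.map_mk'_self, sup_bot_eq] at h

end PLength

/-! ### The criterion for `p`-supersolvability -/

theorem theorem1p2 {G : Type*} [Group G] [Finite G] (p : ℕ) [Fact p.Prime]
    (hG : IsPSolvable p G) (P : Sylow p G)
    (hH : ∃ H : Subgroup G,
      (commutator (P : Subgroup G)).map (P : Subgroup G).subtype ≤ H ∧
      H ≤ (frattini (P : Subgroup G)).map (P : Subgroup G).subtype ∧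
      IsSSemipermutable H)
    (hN : IsPSupersolvable p (Subgroup.normalizer (P : Set G))) :
    IsPSupersolvable p G := by
  obtain ⟨H, hcomm, hfrat, hsemi⟩ := hH
  have hHP : H ≤ P := hfrat.trans (Subgroup.map_subtype_le _)
  have h : IsNongeneratingPermutable P H := by
    refine ⟨by rwa [Subgroup.map_subtype_commutator] at hcomm, hHP, fun S hS hSH => ?_,
      fun q hq hqp Q => hsemi q hq (fun hdvd => hqp ?_) Q⟩
    -- The image of `Φ(P)` consists of nongenerators of `P`.
    · have hle : H.subgroupOf P ≤ frattini (P : Subgroup G) := by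
        rw [← Subgroup.comap_map_eq_self_of_injective (P : Subgroup G).subtype_injective
          (frattini (P : Subgroup G))]
        exact Subgroup.comap_mono hfrat
      have htop : S.subgroupOf P ⊔ frattini (P : Subgroup G) = ⊤ := by
        refine top_le_iff.1 (le_trans ?_ (sup_le_sup_left hle _))
        rw [← Subgroup.subgroupOf_sup hS hHP, hSH, Subgroup.subgroupOf_self]
      exact le_antisymm hS (Subgroup.subgroupOf_eq_top.1 (frattini_nongenerating htop))
    · obtain ⟨n, hn⟩ := IsPGroup.iff_card.1 (P.isPGroup'.to_le hHP)
      exact (Nat.prime_dvd_prime_iff_eq hq Fact.out).1 (hq.dvd_of_dvd_pow (hn ▸ hdvd))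
  obtain ⟨K, hK, hKp, hPK⟩ := h.exists_normal_sup_normal hG
  exact IsPSupersolvable.of_normalizer P hN hKp hPK
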